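/- Let $0<\alpha<1$ and $\theta>-\alpha$, let $V_1,V_2,\dots$ be independent random variables on a probability space with $V_j\sim\mathrm{beta}(1-\alpha,\theta+j\alpha)$ (the stick-breaking variables of the Pitman–Yor process), and put $R_n=\prod_{j\le n}(1-V_j)$ and $\tau(\epsilon)=\min\{n\ge 1: R_n<\epsilon\}$ for $\epsilon\in(0,1)$. Let $f_\alpha$ be the density of the positive stable law of exponent $\alpha$, that is, of the law on $(0,\infty)$ with Laplace transform $\int_0^\infty e^{-st}f_\alpha(t)\,dt=e^{-s^\alpha}$, $s\ge 0$. Then almost surely $\tau(\epsilon)$ is well defined (the set is nonempty) for all $\epsilon\in(0,1)$, and there is a random variable $T_{\alpha,\theta}$ on the same probability space with density $$f_{\alpha,\theta}(t)=\frac{\Gamma(\theta+1)}{\Gamma(\theta/\alpha+1)}\,t^{-\theta}f_\alpha(t),\qquad t>0,$$ such that, almost surely, $$\tau(\epsilon)-1\sim\left(\frac{\epsilon\,T_{\alpha,\theta}}{\alpha}\right)^{-\alpha/(1-\alpha)}\qquad\text{as }\epsilon\downarrow 0,$$ i.e. the ratio of the two sides tends to $1$. In particular, almost surely, $\tau(\epsilon)$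 has the exact polynomial order $\epsilon^{-\alpha/(1-\alpha)}$: there are random constants $0<c\le C<\infty$ with $c\,\epsilon^{-\alpha/(1-\alpha)}\le\tau(\epsilon)\le C\,\epsilon^{-\alpha/(1-\alpha)}$ for all sufficiently small $\epsilon>0$. -/

import Mathlib

open MeasureTheory ProbabilityTheory Filter Topology Asymptotics

noncomputable section

namespace PitmanYor

/-- The stick-breaking variables of the Pitman–Yor process with parameters `α`, `θ`: independent
random variables, the `j`-th of which (`j = 1, 2, …`) has law `beta (1 - α, θ + j α)`.
The sequence is indexed from `0`, so that `V j` is the `(j + 1)`-st variable. -/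
structure IsStickBreaking {Ω : Type*} [MeasurableSpace Ω] (P : Measure Ω) (α θ : ℝ)
    (V : ℕ → Ω → ℝ) : Prop where
  indep : iIndepFun V P
  law : ∀ j : ℕ, HasLaw (V j) (betaMeasure (1 - α) (θ + ((j : ℝ) + 1) * α)) P

/-- The truncation error `R_n = ∏_{j ≤ n} (1 - V_j)` (the product of the first `n` factors). -/
def truncError {Ω : Type*} (V : ℕ → Ω → ℝ) (n : ℕ) (ω : Ω) : ℝ :=
  ∏ j ∈ Finset.range n, (1 - V j ω)

/-- The truncation point `τ(ε) = min {n ≥ 1 : R_n < ε}`. -/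
def truncPoint {Ω : Type*} (V : ℕ → Ω → ℝ) (ε : ℝ) (ω : Ω) : ℕ :=
  sInf {n : ℕ | 1 ≤ n ∧ truncError V n ω < ε}

/-- `f` is a density (with respect to Lebesgue measure) of the positive stable law of exponent `α`,
i.e. of the law on `(0, ∞)` with Laplace transform `s ↦ exp (-s ^ α)`. The case `s = 0` says that
the total mass is `1`. -/
structure IsPositiveStableDensity (α : ℝ) (f : ℝ → ℝ) : Prop where
  measurable : Measurable f
  nonneg : ∀ t, 0 ≤ f t
  eq_zero : ∀ t, t ≤ 0 → f t = 0
  laplace : ∀ s : ℝ, 0 ≤ s → ∫ t, Real.exp (-s * t) * f t = Real.exp (-(s ^ α))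

/-- The polynomially tilted density `Γ(θ + 1) / Γ(θ / α + 1) * t ^ (-θ) * f t` on `t > 0`. -/
def tiltedDensity (α θ : ℝ) (f : ℝ → ℝ) (t : ℝ) : ℝ :=
  if 0 < t then Real.Gamma (θ + 1) / Real.Gamma (θ / α + 1) * t ^ (-θ) * f t else 0

/-- `T` is a polynomially tilted positive stable random variable `T_{α,θ}`: its law has density
`Γ(θ + 1) / Γ(θ / α + 1) * t ^ (-θ) * f_α t` on `(0, ∞)`, where `f_α` is the density of the positive
stable law of exponent `α`. -/
def IsTiltedStable {Ω : Type*} [MeasurableSpace Ω] (P : Measure Ω) (α θ : ℝ) (T : Ω → ℝ) : Prop :=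
  ∃ f : ℝ → ℝ, IsPositiveStableDensity α f ∧
    HasLaw T (volume.withDensity fun t => ENNReal.ofReal (tiltedDensity α θ f t)) P

end PitmanYor

end

open scoped ENNReal

/-! Put `Z n = n ^ ((1 - α) / α) / α * R_n`. By independence the `s`-th moment of `R_n` is a product
of beta ratios, which collapses to Gamma quotients (`prod_beta_ratio`); `Γ (x + s) ∼ x ^ s Γ x` then
gives convergence of the moments of `Z n` to `limitMoment α θ s` for every `s > -(θ + α)`.

The product of the `(1 - V_j) ^ s` divided by their means is a nonnegative martingale, so `Z n ^ s`
converges almost surely. Taking `s = 1` and one negative `s` yields a limit `L` in `(0, ∞)`, and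
bounds on slightly higher moments carry the moments over to `L`. Set `T = L⁻¹`.

To identify `T`, undo the tilt: the negative moments become those of the positive stable law
(`limitMoment_sub`). They fix the Mellin transform of the Laplace transform, hence the Laplace
transform itself (`laplace_eq_of_moments`). A density exists because `L` has an independent
absolutely continuous factor `1 - V_1`.

The rest is deterministic: `R_τ < ε ≤ R_{τ-1}` turns the power law for `R_n` into the one for
`τ(ε)`. -/

namespace PitmanYor

/-! ### Asymptotics of Gamma quotients -/

/-- Wendel's bounds give `Γ (x + s) ∼ x ^ s Γ x` for `0 < s < 1`. -/
theorem tendsto_Gamma_ratio_of_mem_Ioo {s : ℝ} (h0 : 0 < s) (h1 : s < 1) :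
    Tendsto (fun x : ℝ => Real.Gamma (x + s) / (Real.Gamma x * x ^ s)) atTop (𝓝 1) := by
  have hlow : Tendsto (fun x : ℝ => (x / (x + s)) ^ (1 - s)) atTop (𝓝 1) := by
    have h : Tendsto (fun x : ℝ => x / (x + s)) atTop (𝓝 1) := by
      have h2 : Tendsto (fun x : ℝ => 1 - s / (x + s)) atTop (𝓝 (1 - 0)) :=
        tendsto_const_nhds.sub
          (tendsto_const_nhds.div_atTop (tendsto_atTop_add_const_right _ _ tendsto_id))
      rw [sub_zero] at h2
      refine h2.congr' ?_
      filter_upwards [eventually_gt_atTop 0] with x hx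
      have : x + s ≠ 0 := by positivity
      field_simp
      ring
    have := h.rpow_const (p := 1 - s) (Or.inl one_ne_zero)
    simpa using this
  refine tendsto_of_tendsto_of_tendsto_of_le_of_le' hlow tendsto_const_nhds ?_ ?_
  · filter_upwards [eventually_gt_atTop 0] with x hx
    have hxs : 0 < x + s := by positivity
    have key := Real.Gamma_mul_add_mul_le_rpow_Gamma_mul_rpow_Gamma (s := x + s)
      (t := x + s + 1) (a := s) (b := 1 - s) hxs (by positivity) h0 (by linarith) (by ring)
    have e : s * (x + s) + (1 - s) * (x + s + 1) = x + 1 := by ring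
    have hG := Real.Gamma_pos_of_pos hxs
    have hGx := Real.Gamma_pos_of_pos hx
    rw [e, Real.Gamma_add_one hx.ne', Real.Gamma_add_one hxs.ne',
      Real.mul_rpow hxs.le hG.le, mul_left_comm, ← Real.rpow_add hG] at key
    simp only [add_sub_cancel, Real.rpow_one] at key
    rw [le_div_iff₀ (by positivity), Real.div_rpow hx.le hxs.le, div_mul_eq_mul_div,
      div_le_iff₀ (by positivity)]
    calc x ^ (1 - s) * (Real.Gamma x * x ^ s) = x ^ (1 - s + s) * Real.Gamma x := by
          rw [Real.rpow_add hx]; ring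
      _ = x * Real.Gamma x := by simp
      _ ≤ _ := by linarith
  · filter_upwards [eventually_gt_atTop 0] with x hx
    have key := Real.Gamma_mul_add_mul_le_rpow_Gamma_mul_rpow_Gamma (s := x)
      (t := x + 1) (a := 1 - s) (b := s) hx (by positivity) (by linarith) h0 (by ring)
    have e : (1 - s) * x + s * (x + 1) = x + s := by ring
    have hGx := Real.Gamma_pos_of_pos hx
    rw [e, Real.Gamma_add_one hx.ne', Real.mul_rpow hx.le hGx.le, mul_left_comm,
      ← Real.rpow_add hGx] at key
    simp only [sub_add_cancel, Real.rpow_one] at key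
    rw [div_le_one (by positivity)]
    linarith

theorem tendsto_add_const_div_self (s : ℝ) :
    Tendsto (fun x : ℝ => (x + s) / x) atTop (𝓝 1) := by
  have h2 : Tendsto (fun x : ℝ => 1 + s / x) atTop (𝓝 (1 + 0)) :=
    tendsto_const_nhds.add (tendsto_const_nhds.div_atTop tendsto_id)
  rw [add_zero] at h2
  refine h2.congr' ?_
  filter_upwards [eventually_gt_atTop 0] with x hx
  field_simp

/-- Pass through `Γ (x + s)`: the only discrepancy is `((x + s) / x) ^ t`, which tends to `1`. With
the companion for `-s`, this spreads the asymptotics from `(0, 1)` to all real exponents. -/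
theorem tendsto_Gamma_ratio_add {s t : ℝ}
    (hs : Tendsto (fun x : ℝ => Real.Gamma (x + s) / (Real.Gamma x * x ^ s)) atTop (𝓝 1))
    (ht : Tendsto (fun x : ℝ => Real.Gamma (x + t) / (Real.Gamma x * x ^ t)) atTop (𝓝 1)) :
    Tendsto (fun x : ℝ => Real.Gamma (x + (s + t)) / (Real.Gamma x * x ^ (s + t)))
      atTop (𝓝 1) := by
  have h1 := ht.comp (tendsto_atTop_add_const_right atTop s tendsto_id)
  have h2 := (tendsto_add_const_div_self s).rpow_const (p := t) (Or.inl one_ne_zero)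
  rw [Real.one_rpow] at h2
  have h := (h1.mul hs).mul h2
  simp only [mul_one] at h
  refine h.congr' ?_
  filter_upwards [eventually_gt_atTop 0, eventually_gt_atTop (-s)] with x hx hxs
  have hxs : 0 < x + s := by linarith
  have := Real.Gamma_pos_of_pos hx
  have := Real.Gamma_pos_of_pos hxs
  simp only [Function.comp, id]
  rw [Real.div_rpow hxs.le hx.le, Real.rpow_add hx, add_assoc]
  have := Real.rpow_pos_of_pos hx s
  have := Real.rpow_pos_of_pos hx t
  have := Real.rpow_pos_of_pos hxs t
  field_simp

theorem tendsto_Gamma_ratio_neg {s : ℝ}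
    (hs : Tendsto (fun x : ℝ => Real.Gamma (x + s) / (Real.Gamma x * x ^ s)) atTop (𝓝 1)) :
    Tendsto (fun x : ℝ => Real.Gamma (x + -s) / (Real.Gamma x * x ^ (-s))) atTop (𝓝 1) := by
  have h1 := (hs.comp (tendsto_atTop_add_const_right atTop (-s) tendsto_id)).inv₀ one_ne_zero
  have h2 := (tendsto_add_const_div_self (-s)).rpow_const (p := -s) (Or.inl one_ne_zero)
  rw [Real.one_rpow] at h2
  have h := h1.mul h2
  simp only [inv_one, mul_one] at h
  refine h.congr' ?_
  filter_upwards [eventually_gt_atTop 0, eventually_gt_atTop s] with x hx hxs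
  have hxs : 0 < x + -s := by linarith
  have := Real.Gamma_pos_of_pos hx
  have := Real.Gamma_pos_of_pos hxs
  simp only [Function.comp, id]
  rw [Real.div_rpow hxs.le hx.le, neg_add_cancel_right, Real.rpow_neg hx.le,
    Real.rpow_neg hxs.le]
  have := Real.rpow_pos_of_pos hx s
  have := Real.rpow_pos_of_pos hxs s
  field_simp

/-- `Γ (x + s) ∼ x ^ s Γ x` as `x → ∞`. -/
theorem tendsto_Gamma_ratio (s : ℝ) :
    Tendsto (fun x : ℝ => Real.Gamma (x + s) / (Real.Gamma x * x ^ s)) atTop (𝓝 1) := by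
  have hzero : Tendsto (fun x : ℝ => Real.Gamma (x + 0) / (Real.Gamma x * x ^ (0 : ℝ)))
      atTop (𝓝 1) := by
    refine tendsto_const_nhds.congr' ?_
    filter_upwards [eventually_gt_atTop 0] with x hx
    have := (Real.Gamma_pos_of_pos hx).ne'
    simp [this]
  have hpos : ∀ s : ℝ, 0 < s →
      Tendsto (fun x : ℝ => Real.Gamma (x + s) / (Real.Gamma x * x ^ s)) atTop (𝓝 1) := by
    intro s hs
    obtain ⟨n, hn⟩ := exists_nat_gt s
    have hn0 : (0 : ℝ) < n := hs.trans hn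
    have hu := tendsto_Gamma_ratio_of_mem_Ioo (s := s / n) (by positivity)
      ((div_lt_one hn0).2 hn)
    have hmul : ∀ k : ℕ, Tendsto (fun x : ℝ => Real.Gamma (x + k * (s / n)) /
        (Real.Gamma x * x ^ (k * (s / n)))) atTop (𝓝 1) := by
      intro k
      induction k with
      | zero => simpa using hzero
      | succ k ih =>
        have := tendsto_Gamma_ratio_add ih hu
        refine this.congr fun x => ?_
        have e : (k : ℝ) * (s / n) + s / n = ((k + 1 : ℕ) : ℝ) * (s / n) := by push_cast; ring
        rw [e]
    have := hmul n
    rwa [mul_div_cancel₀ _ hn0.ne'] at this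
  rcases lt_trichotomy s 0 with h | h | h
  · simpa using tendsto_Gamma_ratio_neg (hpos (-s) (by linarith))
  · rw [h]; exact hzero
  · exact hpos s h

/-! ### Products of beta ratios and their limit -/

/-- The `s`-th moment of the limit of the renormalised truncation errors. -/
noncomputable def limitMoment (α θ s : ℝ) : ℝ :=
  Real.Gamma (θ + 1) * Real.Gamma ((θ + s) / α + 1) /
    (Real.Gamma (θ / α + 1) * Real.Gamma (θ + s + 1))

theorem beta_ratio_eq {a b s : ℝ} (ha : 0 < a) :
    beta a (b + s) / beta a b =
      Real.Gamma (b + s) * Real.Gamma (a + b) / (Real.Gamma b * Real.Gamma (a + b + s)) := by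
  have := (Real.Gamma_pos_of_pos ha).ne'
  rw [beta, beta, ← add_assoc]
  field_simp

/-- The product nearly telescopes: with `b = θ + (n + 1) α`, the number `1 - α + b` exceeds the
preceding parameter by exactly `1`. The leftover linear factors `(b + s) / b` are absorbed by Gamma
functions of `b / α` and `(b + s) / α`. The bound on `s` keeps all arguments positive. -/
theorem prod_beta_ratio {α θ s : ℝ} (hα0 : 0 < α) (hα1 : α < 1) (hθ : -α < θ)
    (hs : -(θ + α) < s) (n : ℕ) :
    ∏ j ∈ Finset.range n, beta (1 - α) (θ + ((j : ℝ) + 1) * α + s) /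
        beta (1 - α) (θ + ((j : ℝ) + 1) * α) =
      Real.Gamma (θ + n * α + 1 + s) / Real.Gamma (θ + n * α + 1) *
        (Real.Gamma (θ / α + n + 1) / Real.Gamma (θ / α + n + 1 + s / α)) *
        limitMoment α θ s := by
  have g : ∀ {x : ℝ}, 0 < x → Real.Gamma x ≠ 0 := fun h => (Real.Gamma_pos_of_pos h).ne'
  induction n with
  | zero =>
    have h1 : 0 < θ + 1 := by linarith
    have h2 : 0 < θ / α + 1 := by
      have : -1 < θ / α := by rw [lt_div_iff₀ hα0]; linarith
      linarith
    have h3 : 0 < θ + s + 1 := by linarith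
    have h4 : 0 < (θ + s) / α + 1 := by
      have : -1 < (θ + s) / α := by rw [lt_div_iff₀ hα0]; linarith
      linarith
    have e1 : θ + 1 + s = θ + s + 1 := by ring
    have e2 : θ / α + 1 + s / α = (θ + s) / α + 1 := by ring
    simp only [Finset.range_zero, Finset.prod_empty, CharP.cast_eq_zero, zero_mul, add_zero,
      limitMoment, e1, e2]
    have := g h1; have := g h2; have := g h3; have := g h4
    generalize Real.Gamma (θ / α + 1) = x, Real.Gamma ((θ + s) / α + 1) = y at *
    field_simp
  | succ n ih =>
    rw [Finset.prod_range_succ, ih, beta_ratio_eq (by linarith)]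
    set b : ℝ := θ + ((n : ℝ) + 1) * α with hb
    have hnα : 0 ≤ (n : ℝ) * α := by positivity
    have hbpos : 0 < b := by rw [hb]; linarith
    have hbs : 0 < b + s := by rw [hb]; linarith
    have e1 : θ + n * α + 1 = 1 - α + b := by rw [hb]; ring
    have e2 : θ / α + n + 1 = b / α := by rw [hb]; field_simp; ring
    have e3 : θ + (n + 1 : ℕ) * α + 1 = b + 1 := by rw [hb]; push_cast; ring
    have e4 : θ / α + (n + 1 : ℕ) + 1 = b / α + 1 := by rw [← e2]; push_cast; ring
    have e5 : b / α + s / α = (b + s) / α := by ring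
    have e6 : b + 1 + s = b + s + 1 := by ring
    have e7 : b / α + 1 + s / α = (b + s) / α + 1 := by ring
    rw [e3, e4, e1, e2, e5, e6, e7, Real.Gamma_add_one hbs.ne', Real.Gamma_add_one hbpos.ne',
      Real.Gamma_add_one (div_pos hbpos hα0).ne', Real.Gamma_add_one (div_pos hbs hα0).ne']
    have := g hbpos; have := g hbs; have := g (div_pos hbpos hα0); have := g (div_pos hbs hα0)
    have : Real.Gamma (1 - α + b) ≠ 0 := g (by linarith)
    have : Real.Gamma (1 - α + b + s) ≠ 0 := g (by linarith)
    field_simp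

theorem tendsto_affine_rpow (a b : ℝ) (hb : 0 < b) (s : ℝ) :
    Tendsto (fun n : ℕ => (a + n * b) ^ s / (n * b) ^ s) atTop (𝓝 1) := by
  have h : Tendsto (fun n : ℕ => (n : ℝ) * b) atTop atTop :=
    tendsto_natCast_atTop_atTop.atTop_mul_const hb
  have h2 := ((tendsto_add_const_div_self a).comp h).rpow_const (p := s) (Or.inl one_ne_zero)
  rw [Real.one_rpow] at h2
  refine h2.congr' ?_
  filter_upwards [h.eventually_gt_atTop 0, h.eventually_gt_atTop (-a)] with n h0 h1
  simp only [Function.comp]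
  rw [Real.div_rpow (by linarith) h0.le, add_comm]

theorem tendsto_prod_beta_ratio {α θ s : ℝ} (hα0 : 0 < α) (hα1 : α < 1) (hθ : -α < θ)
    (hs : -(θ + α) < s) :
    Tendsto (fun n : ℕ => ((n : ℝ) ^ ((1 - α) / α) / α) ^ s *
      ∏ j ∈ Finset.range n, beta (1 - α) (θ + ((j : ℝ) + 1) * α + s) /
        beta (1 - α) (θ + ((j : ℝ) + 1) * α)) atTop (𝓝 (limitMoment α θ s)) := by
  have hx : Tendsto (fun n : ℕ => (θ + 1) + (n : ℝ) * α) atTop atTop :=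
    tendsto_atTop_add_const_left _ _ (tendsto_natCast_atTop_atTop.atTop_mul_const hα0)
  have hy : Tendsto (fun n : ℕ => (θ / α + 1) + (n : ℝ) * 1) atTop atTop :=
    tendsto_atTop_add_const_left _ _ (tendsto_natCast_atTop_atTop.atTop_mul_const one_pos)
  have A := ((tendsto_Gamma_ratio s).comp hx).mul (tendsto_affine_rpow (θ + 1) α hα0 s)
  have B := (((tendsto_Gamma_ratio (s / α)).comp hy).mul
    (tendsto_affine_rpow (θ / α + 1) 1 one_pos (s / α))).inv₀ (by norm_num)
  have C := (A.mul B).mul_const (limitMoment α θ s)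
  simp only [mul_one, inv_one, one_mul] at C
  refine C.congr' ?_
  filter_upwards [hx.eventually_gt_atTop 0, hy.eventually_gt_atTop 0, eventually_gt_atTop 0]
    with n h1 h2 h3
  rw [prod_beta_ratio hα0 hα1 hθ hs]
  have hn : (0 : ℝ) < n := by exact_mod_cast h3
  rw [mul_one] at h2
  have e1 : θ + n * α + 1 = θ + 1 + n * α := by ring
  have e2 : θ / α + n + 1 = θ / α + 1 + n := by ring
  -- The normalisation is the quotient of the two growth rates: `(n α) ^ s` from the Gamma quotient
  -- in `θ + n α`, `n ^ (s / α)` from the one in `θ / α + n`.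
  have e3 : ((n : ℝ) ^ ((1 - α) / α) / α) ^ s = (n : ℝ) ^ (s / α) / (n * α) ^ s := by
    rw [Real.div_rpow (by positivity) hα0.le, Real.mul_rpow hn.le hα0.le, ← Real.rpow_mul hn.le]
    have : (n : ℝ) ^ ((1 - α) / α * s) = (n : ℝ) ^ (s / α) / (n : ℝ) ^ s := by
      rw [← Real.rpow_sub hn]; congr 1; field_simp
    rw [this, div_div]
  simp only [Function.comp]
  rw [e1, e2, e3]
  have := Real.Gamma_pos_of_pos h1
  have := Real.Gamma_pos_of_pos h2
  have := Real.rpow_pos_of_pos h1 s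
  have := Real.rpow_pos_of_pos h2 (s / α)
  have := Real.rpow_pos_of_pos hn (s / α)
  have := Real.rpow_pos_of_pos (mul_pos hn hα0) s
  generalize θ / α + 1 + (n : ℝ) = y at *
  -- If this value vanishes, both sides are `0` by division by zero, so positivity of `y + s / α` is
  -- not needed.
  by_cases hz : Real.Gamma (y + s / α) = 0
  · simp [hz]
  · generalize s / α = u at *
    field_simp

/-! ### Power moments of the beta law -/

theorem ae_betaMeasure_mem_Ioo (a b : ℝ) : ∀ᵐ x ∂betaMeasure a b, 0 < x ∧ x < 1 := by
  rw [betaMeasure, ae_withDensity_iff (by unfold betaPDF; fun_prop)]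
  refine ae_of_all _ fun x hx => ?_
  by_contra h
  exact hx (by simp [betaPDF_eq, h])

theorem betaPDF_mul_rpow {a b s : ℝ} (ha : 0 < a) (hb : 0 < b) (hbs : 0 < b + s) (x : ℝ) :
    betaPDF a b x * ENNReal.ofReal ((1 - x) ^ s) =
      ENNReal.ofReal (beta a (b + s) / beta a b) * betaPDF a (b + s) x := by
  by_cases h : 0 < x ∧ x < 1
  · rw [betaPDF_of_pos_lt_one h.1 h.2, betaPDF_of_pos_lt_one h.1 h.2]
    have h1 : 0 < 1 - x := by linarith [h.2]
    have hb1 := beta_pos ha hb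
    have hb2 := beta_pos ha hbs
    have := Real.rpow_pos_of_pos h.1 (a - 1)
    have := Real.rpow_pos_of_pos h1 (b - 1)
    rw [← ENNReal.ofReal_mul (by positivity), ← ENNReal.ofReal_mul (by positivity)]
    congr 1
    rw [show b + s - 1 = (b - 1) + s by ring, Real.rpow_add h1]
    field_simp
  · simp [betaPDF_eq, h]

theorem lintegral_betaMeasure_rpow {a b s : ℝ} (ha : 0 < a) (hb : 0 < b) (hbs : 0 < b + s) :
    ∫⁻ x, ENNReal.ofReal ((1 - x) ^ s) ∂betaMeasure a b =
      ENNReal.ofReal (beta a (b + s) / beta a b) := by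
  rw [betaMeasure, lintegral_withDensity_eq_lintegral_mul _ (by unfold betaPDF; fun_prop)
    (by fun_prop)]
  simp only [Pi.mul_apply, betaPDF_mul_rpow ha hb hbs]
  rw [lintegral_const_mul _ (by unfold betaPDF; fun_prop), lintegral_betaPDF_eq_one ha hbs,
    mul_one]

/-! ### Passing moments to the limit, product martingales, Mellin uniqueness -/

/-- A bound on a moment of order `p > 1` prevents loss of mass in the limit. -/
theorem lintegral_eq_of_tendsto_of_rpow_bdd {Ω : Type*} [MeasurableSpace Ω] {P : Measure Ω}
    [IsFiniteMeasure P] {F : ℕ → Ω → ℝ≥0∞} {G : Ω → ℝ≥0∞} (hF : ∀ n, Measurable (F n))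
    (hlim : ∀ᵐ ω ∂P, Tendsto (fun n => F n ω) atTop (𝓝 (G ω))) {p : ℝ} (hp : 1 < p)
    {C : ℝ≥0∞} (hC : C ≠ ∞) (hbdd : ∀ n, ∫⁻ ω, F n ω ^ p ∂P ≤ C) {m : ℝ≥0∞}
    (hm : Tendsto (fun n => ∫⁻ ω, F n ω ∂P) atTop (𝓝 m)) :
    ∫⁻ ω, G ω ∂P = m := by
  apply le_antisymm
  · calc ∫⁻ ω, G ω ∂P = ∫⁻ ω, liminf (fun n => F n ω) atTop ∂P :=
          lintegral_congr_ae (hlim.mono fun ω h => h.liminf_eq.symm)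
      _ ≤ liminf (fun n => ∫⁻ ω, F n ω ∂P) atTop := lintegral_liminf_le hF
      _ = m := hm.liminf_eq
  · have key : ∀ K : ℕ, 0 < K → m ≤ ∫⁻ ω, G ω ∂P + C / (K : ℝ≥0∞) ^ (p - 1) := by
      intro K hK
      have hK0 : (K : ℝ≥0∞) ≠ 0 := by exact_mod_cast hK.ne'
      have hKt : (K : ℝ≥0∞) ≠ ∞ := ENNReal.natCast_ne_top K
      have hpw : ∀ x : ℝ≥0∞, x ≤ min x K + x ^ p / (K : ℝ≥0∞) ^ (p - 1) := by
        intro x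
        rcases le_total x K with h | h
        · rw [min_eq_left h]; exact le_self_add
        · refine le_add_left ?_
          rw [ENNReal.le_div_iff_mul_le (Or.inl (by simp [hK0, hKt]))
            (Or.inl (by simp [hK0, hKt]))]
          calc x * (K : ℝ≥0∞) ^ (p - 1) ≤ x * x ^ (p - 1) := by
                gcongr
            _ = x ^ (1 : ℝ) * x ^ (p - 1) := by rw [ENNReal.rpow_one]
            _ = x ^ p := by
                rw [← ENNReal.rpow_add_of_nonneg _ _ zero_le_one (by linarith)]
                congr 1; ring
      have htrunc : Tendsto (fun n => ∫⁻ ω, min (F n ω) K ∂P) atTop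
          (𝓝 (∫⁻ ω, min (G ω) K ∂P)) := by
        refine tendsto_lintegral_of_dominated_convergence (fun _ => (K : ℝ≥0∞))
          (fun n => (hF n).min measurable_const) (fun n => ae_of_all _ fun ω => min_le_right _ _)
          ?_ ?_
        · rw [lintegral_const]; exact ENNReal.mul_ne_top hKt (measure_ne_top _ _)
        · filter_upwards [hlim] with ω h using h.min tendsto_const_nhds
      have h2 := htrunc.add_const (C / (K : ℝ≥0∞) ^ (p - 1))
      refine (le_of_tendsto_of_tendsto' hm h2 fun n => ?_).trans ?_
      · calc ∫⁻ ω, F n ω ∂P ≤ ∫⁻ ω, (min (F n ω) K + F n ω ^ p / (K : ℝ≥0∞) ^ (p - 1)) ∂P :=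
              lintegral_mono fun ω => hpw _
          _ = ∫⁻ ω, min (F n ω) K ∂P + (∫⁻ ω, F n ω ^ p ∂P) / (K : ℝ≥0∞) ^ (p - 1) := by
              rw [lintegral_add_left ((hF n).min measurable_const)]
              simp only [div_eq_mul_inv]
              rw [lintegral_mul_const _ ((hF n).pow_const p)]
          _ ≤ _ := by gcongr; exact hbdd n
      · gcongr
        exact min_le_left _ _
    have hlimK : Tendsto (fun K : ℕ => ∫⁻ ω, G ω ∂P + C / (K : ℝ≥0∞) ^ (p - 1)) atTop
        (𝓝 (∫⁻ ω, G ω ∂P + 0)) := by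
      refine tendsto_const_nhds.add ?_
      have h1 : Tendsto (fun K : ℕ => (K : ℝ≥0∞) ^ (p - 1)) atTop (𝓝 ∞) := by
        have := (ENNReal.tendsto_rpow_at_top (y := p - 1) (by linarith)).comp
          ENNReal.tendsto_nat_nhds_top
        exact this
      have h2 := ENNReal.Tendsto.const_div (a := C) h1 (Or.inr hC)
      rwa [ENNReal.div_top] at h2
    rw [add_zero] at hlimK
    exact ge_of_tendsto hlimK ((eventually_gt_atTop 0).mono key)

/-- Products of independent nonnegative variables of mean one converge almost surely. -/
theorem ae_exists_tendsto_prod {Ω : Type*} [MeasurableSpace Ω] {P : Measure Ω}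
    [IsProbabilityMeasure P] {ξ : ℕ → Ω → ℝ} (hm : ∀ j, Measurable (ξ j)) (hi : iIndepFun ξ P)
    (h0 : ∀ j ω, 0 ≤ ξ j ω) (hint : ∀ j, Integrable (ξ j) P) (h1 : ∀ j, ∫ ω, ξ j ω ∂P = 1) :
    ∀ᵐ ω ∂P, ∃ c, Tendsto (fun n => ∏ j ∈ Finset.range n, ξ j ω) atTop (𝓝 c) := by
  have hsm : ∀ j, StronglyMeasurable (ξ j) := fun j => (hm j).stronglyMeasurable
  set 𝒢 := Filtration.natural ξ hsm with h𝒢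
  -- The shift by one makes `M n` involve exactly the variables up to index `n`, hence adapted to
  -- the natural filtration.
  let M : ℕ → Ω → ℝ := fun n => ∏ j ∈ Finset.range (n + 1), ξ j
  have hMind : ∀ n, IndepFun (∏ j ∈ Finset.range n, ξ j) (ξ n) P := fun n =>
    hi.indepFun_prod_range_succ hm n
  have hM : ∀ n, Integrable (∏ j ∈ Finset.range n, ξ j) P ∧
      ∫ ω, (∏ j ∈ Finset.range n, ξ j) ω ∂P = 1 := by
    intro n
    induction n with
    | zero => exact ⟨integrable_const 1, by simp⟩
    | succ n ih =>
      rw [Finset.prod_range_succ]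
      refine ⟨(hMind n).integrable_mul ih.1 (hint n), ?_⟩
      rw [(hMind n).integral_mul_eq_mul_integral ih.1.aestronglyMeasurable
        (hint n).aestronglyMeasurable, ih.2, h1, mul_one]
  have hadp : StronglyAdapted 𝒢 M := by
    intro n
    refine Finset.stronglyMeasurable_prod _ fun j hj => ?_
    exact (Filtration.stronglyAdapted_natural hsm j).mono
      (𝒢.mono (Nat.lt_succ_iff.1 (Finset.mem_range.1 hj)))
  have hmart : Martingale M 𝒢 P := by
    refine martingale_nat hadp (fun n => (hM (n + 1)).1) fun n => ?_
    have hstep : M (n + 1) = M n * ξ (n + 1) := Finset.prod_range_succ _ _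
    rw [hstep]
    have hc := condExp_mul_of_stronglyMeasurable_left (hadp n)
      (hstep ▸ (hM (n + 2)).1) (hint (n + 1))
    have hc2 := iIndepFun.condExp_natural_ae_eq_of_lt hsm hi (Nat.lt_succ_self n)
    filter_upwards [hc, hc2] with ω e1 e2
    rw [e1, Pi.mul_apply, e2, h1, mul_one]
  have hbd : ∀ n, eLpNorm (M n) 1 P ≤ (1 : NNReal) := by
    intro n
    rw [eLpNorm_one_eq_lintegral_enorm]
    have hnn : ∀ ω, 0 ≤ M n ω := fun ω => by
      simp only [M, Finset.prod_apply]
      exact Finset.prod_nonneg fun j _ => h0 j ω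
    have : ∫⁻ ω, ‖M n ω‖ₑ ∂P = ENNReal.ofReal (∫ ω, M n ω ∂P) := by
      rw [ofReal_integral_eq_lintegral_ofReal (hM (n + 1)).1 (ae_of_all _ hnn)]
      exact lintegral_congr fun ω => Real.enorm_of_nonneg (hnn ω)
    rw [this, (hM (n + 1)).2]
    simp
  filter_upwards [hmart.submartingale.exists_ae_tendsto_of_bdd hbd] with ω ⟨c, hc⟩
  refine ⟨c, (tendsto_add_atTop_iff_nat 1).1 ?_⟩
  simpa only [M, Finset.prod_apply] using hc

/-- The Mellin transform, on a neighbourhood of the origin, determines a finite measure on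
the positive half line. -/
theorem ext_of_lintegral_rpow {μ ν : Measure ℝ} (hμ : ∀ᵐ x ∂μ, 0 < x) (hν : ∀ᵐ x ∂ν, 0 < x)
    (hfin : ∀ t : ℝ, -1 < t → ∫⁻ x, ENNReal.ofReal (x ^ t) ∂μ ≠ ∞)
    (h : ∀ t : ℝ, -1 < t → ∫⁻ x, ENNReal.ofReal (x ^ t) ∂μ = ∫⁻ x, ENNReal.ofReal (x ^ t) ∂ν) :
    μ = ν := by
  -- The Mellin transform is the moment generating function of `log`.
  have hexp : ∀ {ρ : Measure ℝ}, (∀ᵐ x ∂ρ, 0 < x) → ∀ t : ℝ,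
      ∫⁻ x, ENNReal.ofReal (Real.exp (t * Real.log x)) ∂ρ = ∫⁻ x, ENNReal.ofReal (x ^ t) ∂ρ := by
    intro ρ hρ t
    refine lintegral_congr_ae (hρ.mono fun x hx => ?_)
    dsimp only
    rw [Real.rpow_def_of_pos hx, mul_comm]
  have hfinite : ∀ {ρ : Measure ℝ}, (∀ t : ℝ, -1 < t → ∫⁻ x, ENNReal.ofReal (x ^ t) ∂ρ ≠ ∞) →
      IsFiniteMeasure ρ := by
    intro ρ hρ
    refine ⟨lt_top_iff_ne_top.2 ?_⟩
    simpa using hρ 0 (by norm_num)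
  have hint : ∀ {ρ : Measure ℝ}, (∀ᵐ x ∂ρ, 0 < x) →
      (∀ t : ℝ, -1 < t → ∫⁻ x, ENNReal.ofReal (x ^ t) ∂ρ ≠ ∞) →
      Set.Ioi (-1) ⊆ interior (integrableExpSet Real.log ρ) := by
    intro ρ h0 hρ
    refine interior_maximal (fun t ht => ?_) isOpen_Ioi
    refine ⟨by fun_prop, ?_⟩
    rw [hasFiniteIntegral_iff_ofReal (ae_of_all _ fun x => (Real.exp_pos _).le), hexp h0]
    exact lt_top_iff_ne_top.2 (hρ t ht)
  have hfin' : ∀ t : ℝ, -1 < t → ∫⁻ x, ENNReal.ofReal (x ^ t) ∂ν ≠ ∞ := fun t ht =>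
    h t ht ▸ hfin t ht
  have := hfinite hfin
  have := hfinite hfin'
  have hmgf : ∀ t : ℝ, -1 < t → mgf Real.log μ t = mgf Real.log ν t := by
    intro t ht
    rw [mgf, mgf, integral_eq_lintegral_of_nonneg_ae (ae_of_all _ fun x => (Real.exp_pos _).le)
      (by fun_prop), integral_eq_lintegral_of_nonneg_ae
      (ae_of_all _ fun x => (Real.exp_pos _).le) (by fun_prop), hexp hμ, hexp hν, h t ht]
  -- Analytic continuation from the real axis to the half plane `re z > -1`; its imaginary axis
  -- carries the characteristic function of `log`.
  have heq : Set.EqOn (complexMGF Real.log μ) (complexMGF Real.log ν) {z | z.re ∈ Set.Ioi (-1)} := by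
    refine AnalyticOnNhd.eqOn_of_preconnected_of_frequently_eq
      (analyticOnNhd_complexMGF.mono fun z hz => hint hμ hfin hz)
      (analyticOnNhd_complexMGF.mono fun z hz => hint hν hfin' hz)
      ((convex_Ioi (-1 : ℝ)).linear_preimage Complex.reLm).isPreconnected
      (z₀ := ((0 : ℝ) : ℂ)) (by simp) ?_
    have h_real : ∃ᶠ (x : ℝ) in 𝓝[≠] 0, complexMGF Real.log μ x = complexMGF Real.log ν x := by
      refine Eventually.frequently ?_
      filter_upwards [nhdsWithin_le_nhds (Ioi_mem_nhds (show (-1 : ℝ) < 0 by norm_num))] with y hy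
      rw [complexMGF_ofReal, complexMGF_ofReal, hmgf y hy]
    rw [frequently_iff_seq_forall] at h_real ⊢
    obtain ⟨xs, hx_tendsto, hx_eq⟩ := h_real
    refine ⟨fun n => xs n, ?_, fun n => hx_eq n⟩
    rw [tendsto_nhdsWithin_iff] at hx_tendsto ⊢
    refine ⟨?_, by simpa using hx_tendsto.2⟩
    exact (Complex.continuous_ofReal.tendsto 0).comp hx_tendsto.1
  have hmap : μ.map Real.log = ν.map Real.log := by
    refine Measure.ext_of_charFun (funext fun t => ?_)
    rw [← complexMGF_mul_I Real.measurable_log.aemeasurable,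
      ← complexMGF_mul_I Real.measurable_log.aemeasurable]
    exact heq (by simp)
  have hback : ∀ {ρ : Measure ℝ}, (∀ᵐ x ∂ρ, 0 < x) → (ρ.map Real.log).map Real.exp = ρ := by
    intro ρ h0
    rw [Measure.map_map Real.measurable_exp Real.measurable_log]
    conv_rhs => rw [← Measure.map_id (μ := ρ)]
    exact Measure.map_congr (h0.mono fun x hx => Real.exp_log hx)
  rw [← hback hμ, ← hback hν, hmap]

/-! ### Pathwise inversion: from the truncation error to the truncation point -/

section Inversion

variable {Ω : Type*} {V : ℕ → Ω → ℝ} {ω : Ω}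

theorem truncError_succ (n : ℕ) :
    truncError V (n + 1) ω = truncError V n ω * (1 - V n ω) :=
  Finset.prod_range_succ _ _

theorem truncError_pos (hV : ∀ j, 0 < V j ω ∧ V j ω < 1) (n : ℕ) : 0 < truncError V n ω :=
  Finset.prod_pos fun j _ => by linarith [(hV j).2]

theorem truncError_antitone (hV : ∀ j, 0 < V j ω ∧ V j ω < 1) :
    Antitone fun n => truncError V n ω := by
  refine antitone_nat_of_succ_le fun n => ?_
  rw [truncError_succ]
  exact mul_le_of_le_one_right (truncError_pos hV n).le (by linarith [(hV n).1])

theorem tendsto_truncError {b c L : ℝ} (hb : 0 < b) (hc : 0 < c)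
    (hL : Tendsto (fun n : ℕ => (n : ℝ) ^ b / c * truncError V n ω) atTop (𝓝 L)) :
    Tendsto (fun n => truncError V n ω) atTop (𝓝 0) := by
  have h1 : Tendsto (fun n : ℕ => c / (n : ℝ) ^ b) atTop (𝓝 0) :=
    tendsto_const_nhds.div_atTop ((tendsto_rpow_atTop hb).comp tendsto_natCast_atTop_atTop)
  have h := hL.mul h1
  rw [mul_zero] at h
  refine h.congr' ?_
  filter_upwards [eventually_gt_atTop 0] with n hn
  have : 0 < (n : ℝ) ^ b := Real.rpow_pos_of_pos (by exact_mod_cast hn) _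
  field_simp

theorem isLeast_truncPoint (h : Tendsto (fun n => truncError V n ω) atTop (𝓝 0)) {ε : ℝ}
    (hε : 0 < ε) : IsLeast {n : ℕ | 1 ≤ n ∧ truncError V n ω < ε} (truncPoint V ε ω) := by
  have hne : {n : ℕ | 1 ≤ n ∧ truncError V n ω < ε}.Nonempty :=
    ((eventually_ge_atTop 1).and (h.eventually_lt_const hε)).exists
  exact ⟨Nat.sInf_mem hne, fun n hn => Nat.sInf_le hn⟩

theorem tendsto_truncPoint (hV : ∀ j, 0 < V j ω ∧ V j ω < 1)
    (h : Tendsto (fun n => truncError V n ω) atTop (𝓝 0)) :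
    Tendsto (fun ε => truncPoint V ε ω) (𝓝[>] 0) atTop := by
  refine tendsto_atTop.2 fun N => ?_
  filter_upwards [Ioo_mem_nhdsGT (truncError_pos hV N)] with ε hε
  by_contra! hlt
  have h1 := (isLeast_truncPoint h hε.1).1.2
  have h2 := truncError_antitone hV hlt.le
  dsimp only at h2
  linarith [hε.2]

/-- With `k = τ(ε) - 1`, minimality gives `R_{k+1} < ε ≤ R_k`. After multiplication by `k ^ b / c`
both ends tend to `L`, the lower one because `(k / (k + 1)) ^ b` tends to `1`. -/
theorem tendsto_rpow_truncPoint (hV : ∀ j, 0 < V j ω ∧ V j ω < 1) {b c L : ℝ} (hb : 0 < b)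
    (hc : 0 < c)
    (hL : Tendsto (fun n : ℕ => (n : ℝ) ^ b / c * truncError V n ω) atTop (𝓝 L)) :
    Tendsto (fun ε => ((truncPoint V ε ω : ℝ) - 1) ^ b / c * ε) (𝓝[>] 0) (𝓝 L) := by
  have h0 := tendsto_truncError hb hc hL
  have hτ := tendsto_truncPoint hV h0
  have hk : Tendsto (fun ε => truncPoint V ε ω - 1) (𝓝[>] 0) atTop :=
    (tendsto_sub_atTop_nat 1).comp hτ
  have hup := hL.comp hk
  have hfrac : Tendsto (fun n : ℕ => ((n : ℝ) / (n + 1)) ^ b) atTop (𝓝 1) := by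
    have := (tendsto_natCast_div_add_atTop (1 : ℝ)).rpow_const (p := b) (Or.inl one_ne_zero)
    simpa using this
  have hlow := ((hL.comp (tendsto_add_atTop_nat 1)).mul hfrac).comp hk
  rw [mul_one] at hlow
  refine tendsto_of_tendsto_of_tendsto_of_le_of_le' hlow hup ?_ ?_
  · filter_upwards [hτ.eventually_ge_atTop 2, self_mem_nhdsWithin] with ε h2 hε
    obtain ⟨k, hk⟩ : ∃ k, truncPoint V ε ω = k + 1 := ⟨truncPoint V ε ω - 1, by omega⟩
    have hlt := (isLeast_truncPoint h0 hε).1.2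
    rw [hk] at hlt
    have hk1 : (0 : ℝ) < (k : ℝ) + 1 := by positivity
    simp only [Function.comp, hk, Nat.add_sub_cancel]
    push_cast
    rw [add_sub_cancel_right, Real.div_rpow (by positivity) hk1.le]
    have := Real.rpow_pos_of_pos hk1 b
    have e : ((k : ℝ) + 1) ^ b / c * truncError V (k + 1) ω * ((k : ℝ) ^ b / ((k : ℝ) + 1) ^ b) =
        (k : ℝ) ^ b / c * truncError V (k + 1) ω := by field_simp
    rw [e]
    gcongr
  · filter_upwards [hτ.eventually_ge_atTop 2, self_mem_nhdsWithin] with ε h2 hε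
    obtain ⟨k, hk⟩ : ∃ k, truncPoint V ε ω = k + 1 := ⟨truncPoint V ε ω - 1, by omega⟩
    have hge : ε ≤ truncError V k ω := by
      by_contra! hlt
      -- Here `τ(ε) ≥ 2` matters: it makes `k ≥ 1` a competitor in the minimum.
      have := (isLeast_truncPoint h0 hε).2 (show k ∈ _ from ⟨by omega, hlt⟩)
      omega
    simp only [Function.comp, hk, Nat.add_sub_cancel]
    push_cast
    rw [add_sub_cancel_right]
    gcongr

theorem truncPoint_isEquivalent (hV : ∀ j, 0 < V j ω ∧ V j ω < 1) {α T : ℝ} (hα0 : 0 < α)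
    (hα1 : α < 1) (hT : 0 < T)
    (hL : Tendsto (fun n : ℕ => (n : ℝ) ^ ((1 - α) / α) / α * truncError V n ω) atTop
      (𝓝 T⁻¹)) :
    (fun ε : ℝ => (truncPoint V ε ω : ℝ) - 1) ~[𝓝[>] 0]
      (fun ε : ℝ => (ε * T / α) ^ (-α / (1 - α))) := by
  have h1α : 0 < 1 - α := by linarith
  have hb : 0 < (1 - α) / α := by positivity
  have hτ := tendsto_truncPoint hV (tendsto_truncError hb hα0 hL)
  refine isEquivalent_of_tendsto_one ?_
  have h := ((tendsto_rpow_truncPoint hV hb hα0 hL).mul_const T).rpow_const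
    (p := α / (1 - α)) (Or.inr (by positivity))
  rw [inv_mul_cancel₀ hT.ne', Real.one_rpow] at h
  refine h.congr' ?_
  filter_upwards [hτ.eventually_ge_atTop 2, self_mem_nhdsWithin] with ε h2 hε
  have hε : 0 < ε := hε
  have hk : (0 : ℝ) ≤ (truncPoint V ε ω : ℝ) - 1 := by
    have : (2 : ℝ) ≤ truncPoint V ε ω := by exact_mod_cast h2
    linarith
  simp only [Pi.div_apply]
  generalize (truncPoint V ε ω : ℝ) - 1 = k at *
  have e : k ^ ((1 - α) / α) / α * ε * T = k ^ ((1 - α) / α) * (ε * T / α) := by ring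
  rw [e, Real.mul_rpow (by positivity) (by positivity), ← Real.rpow_mul hk, neg_div,
    Real.rpow_neg (by positivity), div_inv_eq_mul]
  congr 1
  rw [show (1 - α) / α * (α / (1 - α)) = 1 by field_simp, Real.rpow_one]

theorem truncPoint_isTheta (hV : ∀ j, 0 < V j ω ∧ V j ω < 1) {α T : ℝ} (hα0 : 0 < α)
    (hα1 : α < 1) (hT : 0 < T)
    (hL : Tendsto (fun n : ℕ => (n : ℝ) ^ ((1 - α) / α) / α * truncError V n ω) atTop
      (𝓝 T⁻¹)) :
    (fun ε : ℝ => (truncPoint V ε ω : ℝ)) =Θ[𝓝[>] 0] (fun ε : ℝ => ε ^ (-α / (1 - α))) := by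
  have h1α : 0 < 1 - α := by linarith
  have hb : 0 < (1 - α) / α := by positivity
  have hτ := tendsto_truncPoint hV (tendsto_truncError hb hα0 hL)
  have hτ' : Tendsto (fun ε => (truncPoint V ε ω : ℝ)) (𝓝[>] 0) atTop :=
    tendsto_natCast_atTop_atTop.comp hτ
  have h1 : (fun ε : ℝ => (truncPoint V ε ω : ℝ) - 1) ~[𝓝[>] 0]
      (fun ε : ℝ => (truncPoint V ε ω : ℝ)) := by
    refine IsLittleO.isEquivalent ?_
    have : ((fun ε : ℝ => (truncPoint V ε ω : ℝ) - 1) - fun ε : ℝ => (truncPoint V ε ω : ℝ)) =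
        fun _ => (-1 : ℝ) := by ext; simp
    rw [this, isLittleO_const_left]
    exact Or.inr (tendsto_norm_atTop_atTop.comp hτ')
  refine h1.symm.isTheta.trans ((truncPoint_isEquivalent hV hα0 hα1 hT hL).isTheta.trans ?_)
  have e : (fun ε : ℝ => (ε * T / α) ^ (-α / (1 - α))) =ᶠ[𝓝[>] 0]
      fun ε => (T / α) ^ (-α / (1 - α)) * ε ^ (-α / (1 - α)) := by
    filter_upwards [self_mem_nhdsWithin] with ε hε
    have hε : 0 < ε := hε
    rw [← Real.mul_rpow (by positivity) hε.le]
    congr 1; ring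
  refine e.isTheta.trans ?_
  have hc : (T / α) ^ (-α / (1 - α)) ≠ 0 := (Real.rpow_pos_of_pos (by positivity) _).ne'
  exact (isTheta_const_mul_left hc).2 (isTheta_refl _ _)

end Inversion

/-! ### Stick factors and almost sure convergence of the renormalised error -/

variable {Ω : Type*} [MeasurableSpace Ω] {P : Measure Ω} {α θ : ℝ} {V W : ℕ → Ω → ℝ}

/-- Everywhere measurable and positive versions of the factors `1 - V j` of the truncation error. -/
structure IsStickFactor (P : Measure Ω) (α θ : ℝ) (W : ℕ → Ω → ℝ) : Prop where
  measurable : ∀ j, Measurable (W j)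
  pos : ∀ j ω, 0 < W j ω
  indep : iIndepFun W P
  moment : ∀ (j : ℕ) (s : ℝ), -(θ + α) < s → ∫⁻ ω, ENNReal.ofReal (W j ω ^ s) ∂P =
    ENNReal.ofReal (beta (1 - α) (θ + ((j : ℝ) + 1) * α + s) /
      beta (1 - α) (θ + ((j : ℝ) + 1) * α))
  absolutelyContinuous : P.map (W 0) ≪ volume

theorem stickParam_add_pos (hα0 : 0 < α) {s : ℝ} (hs : -(θ + α) < s) (j : ℕ) :
    0 < θ + ((j : ℝ) + 1) * α + s := by
  have : 0 ≤ (j : ℝ) * α := by positivity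
  linarith

theorem stickParam_pos (hα0 : 0 < α) (hθ : -α < θ) (j : ℕ) : 0 < θ + ((j : ℝ) + 1) * α := by
  simpa using stickParam_add_pos hα0 (show -(θ + α) < 0 by linarith) j

theorem IsStickBreaking.ae_mem_Ioo (hV : IsStickBreaking P α θ V) :
    ∀ᵐ ω ∂P, ∀ j, 0 < V j ω ∧ V j ω < 1 := by
  rw [ae_all_iff]
  intro j
  have h := ae_betaMeasure_mem_Ioo (1 - α) (θ + ((j : ℝ) + 1) * α)
  rw [← (hV.law j).map_eq] at h
  exact ae_of_ae_map (hV.law j).aemeasurable h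

theorem IsStickBreaking.exists_isStickFactor (hV : IsStickBreaking P α θ V)
    (hα0 : 0 < α) (hα1 : α < 1) (hθ : -α < θ) :
    ∃ W, IsStickFactor P α θ W ∧ ∀ᵐ ω ∂P, ∀ j, W j ω = 1 - V j ω := by
  -- `exp ∘ log` changes nothing where `V j < 1` and forces positivity everywhere else.
  let W : ℕ → Ω → ℝ := fun j ω => Real.exp (Real.log (1 - (hV.law j).aemeasurable.mk _ ω))
  have hWm : ∀ j, Measurable (W j) := fun j =>
    ((measurable_const.sub (hV.law j).aemeasurable.measurable_mk).log).exp
  have hmk : ∀ j, W j =ᵐ[P] fun ω => 1 - V j ω := by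
    intro j
    filter_upwards [(hV.law j).aemeasurable.ae_eq_mk, hV.ae_mem_Ioo] with ω h1 h2
    simp only [W]
    rw [← h1, Real.exp_log (by linarith [(h2 j).2])]
  refine ⟨W, ⟨hWm, fun j ω => Real.exp_pos _, ?_, ?_, ?_⟩, ae_all_iff.2 hmk⟩
  · have := hV.indep.comp (fun _ x => 1 - x) fun _ => measurable_const.sub measurable_id
    exact this.congr fun j => (hmk j).symm
  · intro j s hs
    have h1 : ∫⁻ ω, ENNReal.ofReal (W j ω ^ s) ∂P =
        ∫⁻ ω, ENNReal.ofReal ((1 - V j ω) ^ s) ∂P :=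
      lintegral_congr_ae ((hmk j).mono fun ω h => by dsimp only; rw [h])
    rw [h1, ← lintegral_betaMeasure_rpow (by linarith) (stickParam_pos hα0 hθ j)
      (stickParam_add_pos hα0 hs j), ← (hV.law j).map_eq]
    exact (lintegral_map' (f := fun x : ℝ => ENNReal.ofReal ((1 - x) ^ s)) (by fun_prop)
      (hV.law j).aemeasurable).symm
  · have h1 : P.map (W 0) = (P.map (V 0)).map fun x => 1 - x := by
      rw [Measure.map_congr (hmk 0), AEMeasurable.map_map_of_aemeasurable (by fun_prop)
        (hV.law 0).aemeasurable]
      rfl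
    rw [h1, (hV.law 0).map_eq, betaMeasure]
    exact ((withDensity_absolutelyContinuous _ _).map (by fun_prop)).trans
      (quasiMeasurePreserving_sub_left_of_right_invariant volume (1 : ℝ)).absolutelyContinuous

/-- The truncation error multiplied by `n ^ ((1 - α) / α) / α`. -/
noncomputable def renormError (α : ℝ) (W : ℕ → Ω → ℝ) (n : ℕ) (ω : Ω) : ℝ :=
  (n : ℝ) ^ ((1 - α) / α) / α * ∏ j ∈ Finset.range n, W j ω

/-- The normalising constants of the moments of `renormError`. -/
noncomputable def renormMoment (α θ s : ℝ) (n : ℕ) : ℝ :=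
  ((n : ℝ) ^ ((1 - α) / α) / α) ^ s *
    ∏ j ∈ Finset.range n, beta (1 - α) (θ + ((j : ℝ) + 1) * α + s) /
      beta (1 - α) (θ + ((j : ℝ) + 1) * α)

namespace IsStickFactor

theorem prod_pos (hW : IsStickFactor P α θ W) (n : ℕ) (ω : Ω) :
    0 < ∏ j ∈ Finset.range n, W j ω :=
  Finset.prod_pos fun j _ => hW.pos j ω

theorem renormError_nonneg (hW : IsStickFactor P α θ W) (hα0 : 0 < α) (n : ℕ) (ω : Ω) :
    0 ≤ renormError α W n ω :=
  mul_nonneg (by positivity) (hW.prod_pos n ω).le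

theorem measurable_renormError (hW : IsStickFactor P α θ W) (n : ℕ) :
    Measurable (renormError α W n) :=
  measurable_const.mul (Finset.measurable_prod _ fun j _ => hW.measurable j)

theorem renormError_rpow (hW : IsStickFactor P α θ W) (hα0 : 0 < α) (n : ℕ) (ω : Ω) (s : ℝ) :
    renormError α W n ω ^ s =
      ((n : ℝ) ^ ((1 - α) / α) / α) ^ s * ∏ j ∈ Finset.range n, W j ω ^ s := by
  rw [renormError, Real.mul_rpow (by positivity) (hW.prod_pos n ω).le,
    Real.finsetProd_rpow _ _ fun j _ => (hW.pos j ω).le]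

theorem indep_rpow (hW : IsStickFactor P α θ W) (s c : ℕ → ℝ) :
    iIndepFun (fun j ω => W j ω ^ s j / c j) P :=
  hW.indep.comp (fun j x => x ^ s j / c j) fun j => by fun_prop

theorem lintegral_renormError_rpow (hW : IsStickFactor P α θ W) (hα0 : 0 < α) (hα1 : α < 1)
    (hθ : -α < θ) {s : ℝ} (hs : -(θ + α) < s) (n : ℕ) :
    ∫⁻ ω, ENNReal.ofReal (renormError α W n ω ^ s) ∂P =
      ENNReal.ofReal (renormMoment α θ s n) := by
  have hind : iIndepFun (fun j ω => ENNReal.ofReal (W j ω ^ s)) P :=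
    hW.indep.comp (fun _ x => ENNReal.ofReal (x ^ s)) fun j => by fun_prop
  have hm : ∀ j, Measurable fun ω => ENNReal.ofReal (W j ω ^ s) := fun j => by
    have := hW.measurable j
    fun_prop
  have hc : 0 ≤ ((n : ℝ) ^ ((1 - α) / α) / α) ^ s := by positivity
  simp only [hW.renormError_rpow hα0, ENNReal.ofReal_mul hc]
  rw [lintegral_const_mul _ (by
    have := hW.measurable
    fun_prop)]
  simp only [ENNReal.ofReal_prod_of_nonneg fun j _ => Real.rpow_nonneg (hW.pos j _).le s]
  rw [lintegral_prod_eq_prod_lintegral_of_indepFun _ _ hind hm, renormMoment,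
    ENNReal.ofReal_mul hc, ENNReal.ofReal_prod_of_nonneg]
  · simp only [hW.moment _ s hs]
  · exact fun j _ => (div_pos (beta_pos (by linarith) (stickParam_add_pos hα0 hs j))
      (beta_pos (by linarith) (stickParam_pos hα0 hθ j))).le

/-- Dividing each `W j ^ s` by its mean gives a convergent mean-one product, and the deterministic
factor this leaves is the convergent sequence of `tendsto_prod_beta_ratio`. -/
theorem ae_exists_tendsto_renormError_rpow [IsProbabilityMeasure P]
    (hW : IsStickFactor P α θ W) (hα0 : 0 < α) (hα1 : α < 1) (hθ : -α < θ) {s : ℝ}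
    (hs : -(θ + α) < s) :
    ∀ᵐ ω ∂P, ∃ c, Tendsto (fun n => renormError α W n ω ^ s) atTop (𝓝 c) := by
  set r : ℕ → ℝ := fun j => beta (1 - α) (θ + ((j : ℝ) + 1) * α + s) /
      beta (1 - α) (θ + ((j : ℝ) + 1) * α) with hr
  have hrpos : ∀ j, 0 < r j := fun j =>
    div_pos (beta_pos (by linarith) (stickParam_add_pos hα0 hs j))
      (beta_pos (by linarith) (stickParam_pos hα0 hθ j))
  have hm : ∀ j, Measurable fun ω => W j ω ^ s := fun j => by
    have := hW.measurable j
    fun_prop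
  have hnn : ∀ j ω, 0 ≤ W j ω ^ s := fun j ω => Real.rpow_nonneg (hW.pos j ω).le s
  have hint : ∀ j, Integrable (fun ω => W j ω ^ s) P := fun j => by
    refine ⟨(hm j).aestronglyMeasurable, ?_⟩
    rw [hasFiniteIntegral_iff_ofReal (ae_of_all _ (hnn j)), hW.moment j s hs]
    exact ENNReal.ofReal_lt_top
  have hmean : ∀ j, ∫ ω, W j ω ^ s / r j ∂P = 1 := fun j => by
    rw [integral_div, integral_eq_lintegral_of_nonneg_ae (ae_of_all _ (hnn j))
      (hm j).aestronglyMeasurable, hW.moment j s hs, ENNReal.toReal_ofReal (hrpos j).le]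
    exact div_self (hrpos j).ne'
  have h := ae_exists_tendsto_prod (ξ := fun j ω => W j ω ^ s / r j)
    (fun j => (hm j).div_const _) (hW.indep_rpow (fun _ => s) r)
    (fun j ω => div_nonneg (hnn j ω) (hrpos j).le) (fun j => (hint j).div_const _) hmean
  filter_upwards [h] with ω ⟨c, hc⟩
  refine ⟨limitMoment α θ s * c,
    ((tendsto_prod_beta_ratio hα0 hα1 hθ hs).mul hc).congr fun n => ?_⟩
  have e : ∏ j ∈ Finset.range n, W j ω ^ s / r j =
      (∏ j ∈ Finset.range n, W j ω ^ s) / ∏ j ∈ Finset.range n, r j := Finset.prod_div_distrib ..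
  rw [hW.renormError_rpow hα0, e]
  have : ∏ j ∈ Finset.range n, r j ≠ 0 := Finset.prod_ne_zero_iff.2 fun j _ => (hrpos j).ne'
  change ((n : ℝ) ^ ((1 - α) / α) / α) ^ s * (∏ j ∈ Finset.range n, r j) *
    ((∏ j ∈ Finset.range n, W j ω ^ s) / ∏ j ∈ Finset.range n, r j) = _
  rw [mul_assoc, mul_div_cancel₀ _ this]

theorem exists_tendsto_renormError [IsProbabilityMeasure P]
    (hW : IsStickFactor P α θ W) (hα0 : 0 < α) (hα1 : α < 1) (hθ : -α < θ) :
    ∃ L : Ω → ℝ, Measurable L ∧ (∀ ω, 0 < L ω) ∧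
      ∀ᵐ ω ∂P, Tendsto (fun n => renormError α W n ω) atTop (𝓝 (L ω)) := by
  set δ := (θ + α) / 2 with hδ
  have hδ0 : 0 < δ := by rw [hδ]; linarith
  have hpos : ∀ᵐ ω ∂P, ∃ c, 0 < c ∧ Tendsto (fun n => renormError α W n ω) atTop (𝓝 c) := by
    filter_upwards [hW.ae_exists_tendsto_renormError_rpow hα0 hα1 hθ
      (show -(θ + α) < 1 by linarith), hW.ae_exists_tendsto_renormError_rpow hα0 hα1 hθ
      (show -(θ + α) < -δ by linarith)] with ω ⟨c, hc⟩ ⟨d, hd⟩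
    simp only [Real.rpow_one] at hc
    refine ⟨c, lt_of_le_of_ne (ge_of_tendsto' hc fun n => hW.renormError_nonneg hα0 n ω) ?_, hc⟩
    -- A zero limit is excluded by the exponent `-δ`: the product of the `δ`-th and `-δ`-th powers
    -- is `1`, yet it would tend to `0 * d`.
    rintro rfl
    have h1 := (hc.rpow_const (p := δ) (Or.inr hδ0.le)).mul hd
    rw [Real.zero_rpow hδ0.ne', zero_mul] at h1
    refine zero_ne_one (tendsto_nhds_unique h1 (tendsto_const_nhds.congr' ?_))
    filter_upwards [eventually_gt_atTop 0] with n hn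
    have hz : 0 < renormError α W n ω := mul_pos
      (div_pos (Real.rpow_pos_of_pos (by exact_mod_cast hn) _) hα0) (hW.prod_pos n ω)
    rw [← Real.rpow_add hz]
    simp
  obtain ⟨L, hLm, hL⟩ := measurable_limit_of_tendsto_metrizable_ae (μ := P) (L := atTop)
    (f := fun n => renormError α W n) (fun n => (hW.measurable_renormError n).aemeasurable)
    (hpos.mono fun ω ⟨c, _, hc⟩ => ⟨c, hc⟩)
  refine ⟨fun ω => if 0 < L ω then L ω else 1,
    Measurable.ite (measurableSet_lt measurable_const hLm) hLm measurable_const, fun ω => ?_, ?_⟩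
  · dsimp only
    split_ifs with h
    · exact h
    · exact one_pos
  · filter_upwards [hL, hpos] with ω h1 ⟨c, hc, h2⟩
    have : 0 < L ω := tendsto_nhds_unique h2 h1 ▸ hc
    simpa [this] using h1

theorem lintegral_limit_rpow [IsProbabilityMeasure P] (hW : IsStickFactor P α θ W)
    (hα0 : 0 < α) (hα1 : α < 1) (hθ : -α < θ) {L : Ω → ℝ} (hLpos : ∀ ω, 0 < L ω)
    (hL : ∀ᵐ ω ∂P, Tendsto (fun n => renormError α W n ω) atTop (𝓝 (L ω))) {s : ℝ}
    (hs : -(θ + α) < s) :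
    ∫⁻ ω, ENNReal.ofReal (L ω ^ s) ∂P = ENNReal.ofReal (limitMoment α θ s) := by
  -- The range of admissible exponents is open, so some `p > 1` keeps `s * p` in it; this moment
  -- supplies the uniform bound.
  obtain ⟨p, hp, hps⟩ : ∃ p : ℝ, 1 < p ∧ -(θ + α) < s * p := by
    rcases le_total 0 s with h | h
    · exact ⟨2, by norm_num, by linarith⟩
    · have hlim : Tendsto (fun p : ℝ => s * p) (𝓝[>] 1) (𝓝 (s * 1)) :=
        (continuous_const.mul continuous_id).continuousWithinAt
      rw [mul_one] at hlim
      obtain ⟨p, h1, h2⟩ := ((hlim.eventually_const_lt hs).and self_mem_nhdsWithin).exists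
      exact ⟨p, h2, h1⟩
  have hmom := fun n => hW.lintegral_renormError_rpow hα0 hα1 hθ hs n
  have hmomp := fun n => hW.lintegral_renormError_rpow hα0 hα1 hθ hps n
  obtain ⟨B, hB⟩ := (tendsto_prod_beta_ratio hα0 hα1 hθ hps).bddAbove_range
  refine lintegral_eq_of_tendsto_of_rpow_bdd
    (F := fun n ω => ENNReal.ofReal (renormError α W n ω ^ s))
    (fun n => ?_) ?_ hp (C := ENNReal.ofReal B) ENNReal.ofReal_ne_top ?_ ?_
  · have := hW.measurable_renormError n
    fun_prop
  · filter_upwards [hL] with ω h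
    exact ENNReal.tendsto_ofReal (h.rpow_const (Or.inl (hLpos ω).ne'))
  · intro n
    have e : ∀ ω, ENNReal.ofReal (renormError α W n ω ^ s) ^ p =
        ENNReal.ofReal (renormError α W n ω ^ (s * p)) := fun ω => by
      have hz := hW.renormError_nonneg hα0 n ω
      rw [ENNReal.ofReal_rpow_of_nonneg (Real.rpow_nonneg hz _) (by linarith), Real.rpow_mul hz]
    simp only [e]
    rw [hmomp n]
    exact ENNReal.ofReal_le_ofReal (hB ⟨n, rfl⟩)
  · simp only [hmom]
    exact ENNReal.tendsto_ofReal (tendsto_prod_beta_ratio hα0 hα1 hθ hs)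

/-! ### Absolute continuity of the limit law -/

theorem indepFun_shift (hW : IsStickFactor P α θ W) :
    IndepFun (fun ω j => W (j + 1) ω) (W 0) P := by
  have h := indep_iSup_of_disjoint (fun j => (hW.measurable j).comap_le) hW.indep
    (S := {j | j ≠ 0}) (T := {0}) (by simp)
  rw [iSup_singleton] at h
  rw [IndepFun_iff_Indep]
  refine indep_of_indep_of_le_left h ?_
  rw [MeasurableSpace.pi, MeasurableSpace.comap_iSup]
  refine iSup_le fun j => ?_
  rw [MeasurableSpace.comap_comp]
  exact le_iSup₂_of_le (j + 1) (Nat.succ_ne_zero j) le_rfl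

theorem volume_preimage_mul_inv {N : Set ℝ} (hN : volume N = 0) {l : ℝ} (hl : l ≠ 0) :
    volume {w : ℝ | (l * w)⁻¹ ∈ N} = 0 := by
  have h1 : volume ((fun x : ℝ => x⁻¹ / l) '' (N \ {0})) = 0 := by
    refine addHaar_image_eq_zero_of_differentiableOn_of_addHaar_eq_zero _ ?_
      (measure_mono_null Set.sdiff_subset hN)
    intro x hx
    exact ((differentiableAt_inv hx.2).div_const l).differentiableWithinAt
  refine measure_mono_null (t := {0} ∪ (fun x : ℝ => x⁻¹ / l) '' (N \ {0})) ?_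
    (measure_union_null (by simp) h1)
  intro w hw
  by_cases h0 : w = 0
  · exact Or.inl h0
  · refine Or.inr ⟨(l * w)⁻¹, ⟨hw, by simp [h0, hl]⟩, ?_⟩
    simp only [inv_inv]
    field_simp

/-- Write `L = X * W 0`, with `X` built from the later factors and so independent of `W 0`. Given `X
≠ 0`, a null set for `L⁻¹` pulls back to a null set for `W 0`; Fubini concludes. -/
theorem map_inv_limit_absolutelyContinuous [IsProbabilityMeasure P] (hW : IsStickFactor P α θ W)
    {L : Ω → ℝ} (hLm : Measurable L) (hLpos : ∀ ω, 0 < L ω)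
    (hL : ∀ᵐ ω ∂P, Tendsto (fun n => renormError α W n ω) atTop (𝓝 (L ω))) :
    P.map (fun ω => (L ω)⁻¹) ≪ volume := by
  let g : ℕ → (ℕ → ℝ) → ℝ := fun n w =>
    ((n + 1 : ℕ) : ℝ) ^ ((1 - α) / α) / α * ∏ j ∈ Finset.range n, w j
  have hgm : ∀ n, Measurable (g n) := fun n =>
    measurable_const.mul (Finset.measurable_prod _ fun j _ => measurable_pi_apply j)
  -- A `limsup` is measurable on all sequences, without a convergence set to handle.
  let G : (ℕ → ℝ) → ℝ := fun w => limsup (fun n => g n w) atTop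
  have hGm : Measurable G := Measurable.limsup hgm
  let X : Ω → ℝ := fun ω => G fun j => W (j + 1) ω
  have hXm : Measurable X := hGm.comp (measurable_pi_lambda _ fun j => hW.measurable (j + 1))
  have hX : ∀ᵐ ω ∂P, X ω = L ω / W 0 ω := by
    filter_upwards [hL] with ω h
    refine Tendsto.limsup_eq ?_
    refine (((tendsto_add_atTop_iff_nat 1).2 h).div_const (W 0 ω)).congr fun n => ?_
    rw [renormError, Finset.prod_range_succ']
    have := (hW.pos 0 ω).ne'
    simp only [g]
    field_simp
  have hind : IndepFun X (W 0) P := hW.indepFun_shift.comp hGm measurable_id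
  refine Measure.AbsolutelyContinuous.mk fun N hN hN0 => ?_
  have hS : MeasurableSet {q : ℝ × ℝ | (q.1 * q.2)⁻¹ ∈ N} :=
    (measurable_fst.mul measurable_snd).inv hN
  have hprod := (indepFun_iff_map_prod_eq_prod_map_map hXm.aemeasurable
    (hW.measurable 0).aemeasurable).1 hind
  have hnull : (P.map fun ω => (X ω, W 0 ω)) {q : ℝ × ℝ | (q.1 * q.2)⁻¹ ∈ N} = 0 := by
    have := Measure.isProbabilityMeasure_map (μ := P) (hW.measurable 0).aemeasurable
    rw [hprod, Measure.measure_prod_null hS]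
    have hX0 : ∀ᵐ x ∂P.map X, x ≠ 0 := by
      rw [ae_map_iff hXm.aemeasurable (show MeasurableSet {x : ℝ | x ≠ 0} from
        (measurableSet_singleton 0).compl)]
      filter_upwards [hX] with ω h
      rw [h]
      exact (div_pos (hLpos ω) (hW.pos 0 ω)).ne'
    filter_upwards [hX0] with l hl
    exact hW.absolutelyContinuous (volume_preimage_mul_inv hN0 hl)
  rw [Measure.map_apply (hXm.prodMk (hW.measurable 0)) hS] at hnull
  rw [Measure.map_apply (show Measurable fun ω => (L ω)⁻¹ from hLm.inv) hN]
  refine (measure_congr ?_).trans hnull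
  filter_upwards [hX] with ω h
  have := (hW.pos 0 ω).ne'
  refine propext ?_
  change (L ω)⁻¹ ∈ N ↔ (X ω * W 0 ω)⁻¹ ∈ N
  rw [h, div_mul_cancel₀ _ this]

end IsStickFactor

/-! ### Identification of the tilted stable law -/

theorem lintegral_rpow_mul_exp_neg_mul {t x : ℝ} (ht : -1 < t) (hx : 0 < x) :
    ∫⁻ l in Set.Ioi (0 : ℝ), ENNReal.ofReal (l ^ t) * ENNReal.ofReal (Real.exp (-l * x)) =
      ENNReal.ofReal (Real.Gamma (t + 1)) * ENNReal.ofReal (x ^ (-(t + 1))) := by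
  have h := Real.integral_rpow_mul_exp_neg_mul_Ioi (a := t + 1) (r := x) (by linarith) hx
  rw [add_sub_cancel_right] at h
  have hG := Real.Gamma_pos_of_pos (show 0 < t + 1 by linarith)
  have hpos : 0 < (1 / x) ^ (t + 1) * Real.Gamma (t + 1) := by positivity
  have hint : Integrable (fun l : ℝ => l ^ t * Real.exp (-(x * l)))
      (volume.restrict (Set.Ioi 0)) := by
    -- Integrability comes from the value of the integral: it is positive, whereas a non-integrable
    -- function has integral `0` by convention.
    by_contra hn
    rw [integral_undef hn] at h
    exact hpos.ne h
  rw [← ENNReal.ofReal_mul hG.le, Real.rpow_neg hx.le, ← Real.inv_rpow hx.le, ← one_div,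
    mul_comm (Real.Gamma _), ← h, ofReal_integral_eq_lintegral_ofReal hint]
  · refine setLIntegral_congr_fun measurableSet_Ioi fun l hl => ?_
    have hl : 0 < l := hl
    rw [← ENNReal.ofReal_mul (by positivity)]
    congr 3; ring
  · refine ae_restrict_of_forall_mem measurableSet_Ioi fun l hl => ?_
    have hl : 0 < l := hl
    dsimp only [Pi.zero_apply]
    positivity

theorem lintegral_rpow_mul_exp_neg_rpow {α t : ℝ} (hα : 0 < α) (ht : -1 < t) :
    ∫⁻ l in Set.Ioi (0 : ℝ), ENNReal.ofReal (l ^ t) * ENNReal.ofReal (Real.exp (-(l ^ α))) =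
      ENNReal.ofReal (1 / α * Real.Gamma ((t + 1) / α)) := by
  have h := integral_rpow_mul_exp_neg_rpow hα ht
  have hG := Real.Gamma_pos_of_pos (show 0 < (t + 1) / α from div_pos (by linarith) hα)
  have hpos : 0 < 1 / α * Real.Gamma ((t + 1) / α) := by positivity
  have hint : Integrable (fun l : ℝ => l ^ t * Real.exp (-l ^ α))
      (volume.restrict (Set.Ioi 0)) := by
    by_contra hn
    rw [integral_undef hn] at h
    exact hpos.ne h
  rw [← h, ofReal_integral_eq_lintegral_ofReal hint]
  · refine setLIntegral_congr_fun measurableSet_Ioi fun l hl => ?_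
    have hl : 0 < l := hl
    rw [← ENNReal.ofReal_mul (by positivity)]
  · refine ae_restrict_of_forall_mem measurableSet_Ioi fun l hl => ?_
    have hl : 0 < l := hl
    dsimp only [Pi.zero_apply]
    positivity

/-- A law on the positive half line with the negative moments of the positive stable law of
exponent `α` has its Laplace transform. -/
theorem laplace_eq_of_moments {α : ℝ} (hα : 0 < α) {ρ : Measure ℝ} [IsProbabilityMeasure ρ]
    (hρ : ∀ᵐ x ∂ρ, 0 < x)
    (hmom : ∀ u : ℝ, 0 < u → ∫⁻ x, ENNReal.ofReal (x ^ (-u)) ∂ρ =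
      ENNReal.ofReal (Real.Gamma (u / α + 1) / Real.Gamma (u + 1)))
    {s : ℝ} (hs : 0 ≤ s) : ∫ x, Real.exp (-s * x) ∂ρ = Real.exp (-(s ^ α)) := by
  rcases hs.eq_or_lt with rfl | hs0
  · simp [Real.zero_rpow hα.ne']
  let Φ : ℝ → ℝ≥0∞ := fun l => ∫⁻ x, ENNReal.ofReal (Real.exp (-l * x)) ∂ρ
  have hjoint : Measurable fun q : ℝ × ℝ => ENNReal.ofReal (Real.exp (-q.1 * q.2)) := by fun_prop
  have hΦm : Measurable Φ := hjoint.lintegral_prod_right'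
  let Ψ : ℝ → ℝ≥0∞ := fun l => ENNReal.ofReal (Real.exp (-(l ^ α)))
  have hΨm : Measurable Ψ := by fun_prop
  set v : Measure ℝ := volume.restrict (Set.Ioi 0) with hv
  have hvpos : ∀ᵐ l ∂v, 0 < l := ae_restrict_mem measurableSet_Ioi
  have hΨmom : ∀ t : ℝ, -1 < t → ∫⁻ l, ENNReal.ofReal (l ^ t) ∂v.withDensity Ψ =
      ENNReal.ofReal (1 / α * Real.Gamma ((t + 1) / α)) := fun t ht => by
    rw [lintegral_withDensity_eq_lintegral_mul _ hΨm (by fun_prop),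
      ← lintegral_rpow_mul_exp_neg_rpow hα ht]
    exact lintegral_congr fun l => mul_comm (Ψ l) _
  -- By Tonelli, the Mellin transform of the Laplace transform at `t` is `Γ (t + 1)` times the
  -- moment of order `-(t + 1)`, which is known.
  have hΦmom : ∀ t : ℝ, -1 < t → ∫⁻ l, ENNReal.ofReal (l ^ t) ∂v.withDensity Φ =
      ENNReal.ofReal (1 / α * Real.Gamma ((t + 1) / α)) := fun t ht => by
    have ht1 : 0 < t + 1 := by linarith
    rw [lintegral_withDensity_eq_lintegral_mul _ hΦm (by fun_prop)]
    calc ∫⁻ l, (Φ * fun l => ENNReal.ofReal (l ^ t)) l ∂v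
        = ∫⁻ l, ∫⁻ x, ENNReal.ofReal (l ^ t) * ENNReal.ofReal (Real.exp (-l * x)) ∂ρ ∂v := by
          refine lintegral_congr fun l => ?_
          rw [lintegral_const_mul _ (by fun_prop), mul_comm]
          rfl
      _ = ∫⁻ x, ∫⁻ l, ENNReal.ofReal (l ^ t) * ENNReal.ofReal (Real.exp (-l * x)) ∂v ∂ρ :=
          lintegral_lintegral_swap (by fun_prop)
      _ = ∫⁻ x, ENNReal.ofReal (Real.Gamma (t + 1)) * ENNReal.ofReal (x ^ (-(t + 1))) ∂ρ :=
          lintegral_congr_ae (hρ.mono fun x hx => lintegral_rpow_mul_exp_neg_mul ht hx)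
      _ = _ := by
          have hG := Real.Gamma_pos_of_pos ht1
          rw [lintegral_const_mul _ (by fun_prop), hmom _ ht1, ← ENNReal.ofReal_mul hG.le,
            Real.Gamma_add_one ht1.ne', Real.Gamma_add_one (div_pos ht1 hα).ne']
          congr 1
          generalize Real.Gamma ((t + 1) / α) = y
          field_simp
  have heq : v.withDensity Φ = v.withDensity Ψ := by
    refine ext_of_lintegral_rpow ?_ ?_ (fun t ht => ?_) fun t ht => ?_
    · exact (withDensity_absolutelyContinuous v Φ).ae_le hvpos
    · exact (withDensity_absolutelyContinuous v Ψ).ae_le hvpos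
    · rw [hΦmom t ht]; exact ENNReal.ofReal_ne_top
    · rw [hΦmom t ht, hΨmom t ht]
  rw [withDensity_eq_iff_of_sigmaFinite hΦm.aemeasurable hΨm.aemeasurable] at heq
  have hφ : ∀ l, ∫ x, Real.exp (-l * x) ∂ρ = (Φ l).toReal := fun l =>
    integral_eq_lintegral_of_nonneg_ae (ae_of_all _ fun x => (Real.exp_pos _).le) (by fun_prop)
  have hae : (fun l => ∫ x, Real.exp (-l * x) ∂ρ) =ᵐ[v] fun l => Real.exp (-(l ^ α)) := by
    filter_upwards [heq] with l hl
    rw [hφ, hl, ENNReal.toReal_ofReal (Real.exp_pos _).le]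
  -- Mellin uniqueness yields equality only almost everywhere; continuity upgrades it to every `s >
  -- 0`.
  have hcont : ContinuousOn (fun l => ∫ x, Real.exp (-l * x) ∂ρ) (Set.Ioi 0) := by
    refine continuousOn_of_dominated (bound := fun _ => 1) (fun l _ => by fun_prop) ?_
      (integrable_const 1) (ae_of_all _ fun x => by fun_prop)
    intro l hl
    filter_upwards [hρ] with x hx
    rw [Real.norm_of_nonneg (Real.exp_pos _).le, Real.exp_le_one_iff]
    have : 0 < l * x := mul_pos hl hx
    linarith
  have hcont2 : ContinuousOn (fun l : ℝ => Real.exp (-(l ^ α))) (Set.Ioi 0) :=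
    (Real.continuous_exp.comp (Real.continuous_rpow_const hα.le).neg).continuousOn
  exact Measure.eqOn_open_of_ae_eq hae isOpen_Ioi hcont hcont2 hs0

theorem gammaRatio_pos {α θ : ℝ} (hα0 : 0 < α) (hα1 : α < 1) (hθ : -α < θ) :
    0 < Real.Gamma (θ + 1) / Real.Gamma (θ / α + 1) := by
  have h2 : -1 < θ / α := by rw [lt_div_iff₀ hα0]; linarith
  exact div_pos (Real.Gamma_pos_of_pos (by linarith)) (Real.Gamma_pos_of_pos (by linarith))

/-- The shift by `θ` separates the tilting constant from the stable moment of order `-u`. -/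
theorem limitMoment_sub (α θ u : ℝ) :
    limitMoment α θ (u - θ) = Real.Gamma (θ + 1) / Real.Gamma (θ / α + 1) *
      (Real.Gamma (u / α + 1) / Real.Gamma (u + 1)) := by
  rw [limitMoment, add_sub_cancel, div_mul_div_comm]

/-- A positive variable with an absolutely continuous law and the moments `limitMoment` of its
inverse is a polynomially tilted stable variable. -/
theorem isTiltedStable_inv {Ω : Type*} [MeasurableSpace Ω] {P : Measure Ω}
    [IsProbabilityMeasure P] {α θ : ℝ} (hα0 : 0 < α) (hα1 : α < 1) (hθ : -α < θ) {L : Ω → ℝ}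
    (hLm : Measurable L) (hLpos : ∀ ω, 0 < L ω)
    (hac : P.map (fun ω => (L ω)⁻¹) ≪ volume)
    (hmom : ∀ s : ℝ, -(θ + α) < s →
      ∫⁻ ω, ENNReal.ofReal (L ω ^ s) ∂P = ENNReal.ofReal (limitMoment α θ s)) :
    IsTiltedStable P α θ fun ω => (L ω)⁻¹ := by
  have hTm : Measurable fun ω => (L ω)⁻¹ := hLm.inv
  set ν := P.map fun ω => (L ω)⁻¹ with hν
  set c := Real.Gamma (θ + 1) / Real.Gamma (θ / α + 1) with hc
  have hc0 : 0 < c := gammaRatio_pos hα0 hα1 hθ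
  have : IsProbabilityMeasure ν := Measure.isProbabilityMeasure_map hTm.aemeasurable
  set g := ν.rnDeriv volume with hg
  have hgm : Measurable g := Measure.measurable_rnDeriv _ _
  have hνg : volume.withDensity g = ν := Measure.withDensity_rnDeriv_eq _ _ hac
  have hνpos : ∀ᵐ t ∂ν, 0 < t := by
    rw [hν, ae_map_iff hTm.aemeasurable measurableSet_Ioi]
    exact ae_of_all _ fun ω => inv_pos.2 (hLpos ω)
  have hg0 : ∀ᵐ t, g t ≠ 0 → 0 < t := by
    rwa [← hνg, ae_withDensity_iff hgm] at hνpos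
  have hgtop : ∀ᵐ t, g t < ∞ := Measure.rnDeriv_lt_top _ _
  -- The candidate stable density is the Radon–Nikodym density of the law of `L⁻¹` with the tilt
  -- divided out.
  let f : ℝ → ℝ := fun t => if 0 < t then (g t).toReal * (t ^ θ / c) else 0
  have hfm : Measurable f := by
    refine Measurable.ite measurableSet_Ioi ?_ measurable_const
    exact hgm.ennreal_toReal.mul (by fun_prop)
  have hf0 : ∀ t, 0 ≤ f t := fun t => by
    simp only [f]
    split_ifs with h
    · positivity
    · exact le_rfl
  have htilt : volume.withDensity (fun t => ENNReal.ofReal (tiltedDensity α θ f t)) = ν := by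
    rw [← hνg]
    refine withDensity_congr_ae ?_
    filter_upwards [hg0, hgtop] with t h1 h2
    by_cases ht : 0 < t
    · simp only [tiltedDensity, f, if_pos ht, ← hc]
      have := Real.rpow_pos_of_pos ht θ
      rw [Real.rpow_neg ht.le]
      have e : c * (t ^ θ)⁻¹ * ((g t).toReal * (t ^ θ / c)) = (g t).toReal := by field_simp
      rw [e, ENNReal.ofReal_toReal h2.ne]
    · rw [tiltedDensity, if_neg ht, ENNReal.ofReal_zero]
      by_contra h
      exact ht (h1 (Ne.symm h))
  set ρ : Measure ℝ := volume.withDensity fun t => ENNReal.ofReal (f t) with hρ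
  have hρν : ρ = ν.withDensity fun t => ENNReal.ofReal (t ^ θ / c) := by
    rw [← hνg, ← withDensity_mul _ hgm (by fun_prop)]
    refine withDensity_congr_ae ?_
    filter_upwards [hg0, hgtop] with t h1 h2
    simp only [Pi.mul_apply, f]
    by_cases ht : 0 < t
    · rw [if_pos ht, ENNReal.ofReal_mul ENNReal.toReal_nonneg, ENNReal.ofReal_toReal h2.ne]
    · have : g t = 0 := by
        by_contra h
        exact ht (h1 h)
      rw [if_neg ht, this, ENNReal.ofReal_zero, zero_mul]
  -- Including `u = 0` shows that the untilted measure has mass one.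
  have hρmom : ∀ u : ℝ, 0 ≤ u → ∫⁻ x, ENNReal.ofReal (x ^ (-u)) ∂ρ =
      ENNReal.ofReal (Real.Gamma (u / α + 1) / Real.Gamma (u + 1)) := fun u hu => by
    rw [hρν, lintegral_withDensity_eq_lintegral_mul _ (by fun_prop) (by fun_prop), hν,
      lintegral_map (by fun_prop) hTm]
    have e : ∀ ω, ((fun t : ℝ => ENNReal.ofReal (t ^ θ / c)) *
        fun x => ENNReal.ofReal (x ^ (-u))) (L ω)⁻¹ =
        ENNReal.ofReal c⁻¹ * ENNReal.ofReal (L ω ^ (u - θ)) := fun ω => by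
      have h := hLpos ω
      have h' := inv_pos.2 h
      rw [Pi.mul_apply, ← ENNReal.ofReal_mul (by positivity), ← ENNReal.ofReal_mul (by positivity)]
      congr 1
      rw [Real.inv_rpow h.le, Real.inv_rpow h.le, Real.rpow_neg h.le, inv_inv, Real.rpow_sub h]
      field_simp
    simp only [e]
    rw [lintegral_const_mul _ (by fun_prop), hmom _ (by linarith), limitMoment_sub, ← hc,
      ← ENNReal.ofReal_mul (by positivity), inv_mul_cancel_left₀ hc0.ne']
  have hρprob : IsProbabilityMeasure ρ := ⟨by simpa using hρmom 0 le_rfl⟩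
  have hρpos : ∀ᵐ t ∂ρ, 0 < t := by
    rw [hρν]
    exact (withDensity_absolutelyContinuous _ _).ae_le hνpos
  refine ⟨f, ⟨hfm, hf0, fun t ht => if_neg (not_lt.2 ht), fun s hs => ?_⟩, hTm.aemeasurable,
    htilt.symm⟩
  rw [← laplace_eq_of_moments hα0 hρpos (fun u hu => hρmom u hu.le) hs, hρ,
    integral_withDensity_eq_integral_toReal_smul (by fun_prop)
      (ae_of_all _ fun t => ENNReal.ofReal_lt_top)]
  refine integral_congr_ae (ae_of_all _ fun t => ?_)
  simp only [smul_eq_mul, ENNReal.toReal_ofReal (hf0 t)]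
  ring

end PitmanYor

/-! ### Assembly with `T = L⁻¹` -/

theorem theorem2 {Ω : Type*} [MeasurableSpace Ω] (P : Measure Ω) [IsProbabilityMeasure P]
    (α θ : ℝ) (hα0 : 0 < α) (hα1 : α < 1) (hθ : -α < θ)
    (V : ℕ → Ω → ℝ) (hV : PitmanYor.IsStickBreaking P α θ V) :
    (∀ᵐ ω ∂P, ∀ ε : ℝ, 0 < ε → ε < 1 →
      IsLeast {n : ℕ | 1 ≤ n ∧ PitmanYor.truncError V n ω < ε} (PitmanYor.truncPoint V ε ω)) ∧
    (∃ T : Ω → ℝ, Measurable T ∧ PitmanYor.IsTiltedStable P α θ T ∧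
      ∀ᵐ ω ∂P, (fun ε : ℝ => (PitmanYor.truncPoint V ε ω : ℝ) - 1) ~[𝓝[>] 0]
        (fun ε : ℝ => (ε * T ω / α) ^ (-α / (1 - α)))) ∧
    (∀ᵐ ω ∂P, (fun ε : ℝ => (PitmanYor.truncPoint V ε ω : ℝ)) =Θ[𝓝[>] 0]
      (fun ε : ℝ => ε ^ (-α / (1 - α)))) := by
  obtain ⟨W, hW, hWV⟩ := hV.exists_isStickFactor hα0 hα1 hθ
  obtain ⟨L, hLm, hLpos, hL⟩ := hW.exists_tendsto_renormError hα0 hα1 hθ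
  have hlim : ∀ᵐ ω ∂P, Tendsto (fun n : ℕ => (n : ℝ) ^ ((1 - α) / α) / α *
      PitmanYor.truncError V n ω) atTop (𝓝 (L ω)⁻¹⁻¹) := by
    filter_upwards [hWV, hL] with ω h1 h2
    rw [inv_inv]
    refine h2.congr fun n => ?_
    simp only [PitmanYor.renormError, PitmanYor.truncError, h1]
  refine ⟨?_, ⟨fun ω => (L ω)⁻¹, hLm.inv, ?_, ?_⟩, ?_⟩
  · filter_upwards [hlim] with ω h ε hε _
    exact PitmanYor.isLeast_truncPoint
      (PitmanYor.tendsto_truncError (div_pos (by linarith) hα0) hα0 h) hε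
  · exact PitmanYor.isTiltedStable_inv hα0 hα1 hθ hLm hLpos
      (hW.map_inv_limit_absolutelyContinuous hLm hLpos hL)
      fun s hs => hW.lintegral_limit_rpow hα0 hα1 hθ hLpos hL hs
  · filter_upwards [hlim, hV.ae_mem_Ioo] with ω h hω
    exact PitmanYor.truncPoint_isEquivalent hω hα0 hα1 (inv_pos.2 (hLpos ω)) h
  · filter_upwards [hlim, hV.ae_mem_Ioo] with ω h hω
    exact PitmanYor.truncPoint_isTheta hω hα0 hα1 (inv_pos.2 (hLpos ω)) h
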